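/- Let $k, r, t$ be positive integers with $2r+1 \le t$ and $t \ge 6r-5$. Let $S_t^r$ be the graph on $t$ vertices obtained from the star $K_{1,t-1}$ by adding $r$ pairwise disjoint edges between leaves, so that it consists of $r$ triangles and $t-2r-1$ pendent edges sharing one common vertex. Let $gr_k(K_3; S_t^r)$ be the least integer $n$ such that every colouring of the edges of the complete graph $K_n$ with colours from a set of $k$ colours contains a rainbow triangle (three edges of pairwise distinct colours) or a monochromatic copy of $S_t^r$. Then $gr_k(K_3;S_t^r)$ exists, and $$ 2(t-1)\cdot 5^{\frac{k-2}{2}}+1 \;\le\; gr_k(K_3;S_t^{r}) \;\le\; [2t+8(r-1)]\cdot 5^{\frac{k-2}{2}}-4(r-1) \quad\text{if $k$ is even,} $$ $$ (t-1)\cdot 5^{\frac{k-1}{2}}+1 \;\le\; gr_k(K_3;S_t^{r}) \;\le\; [t+4(r-1)]\cdot 5^{\frac{k-1}{2}}-4(r-1) \quad\text{if $k$ is odd.} $$ -/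

import Mathlib

namespace GallaiRamsey

/-- The graph `S_t^r` on the vertex set `{0, …, t - 1}`: the star of order `t` with centre `0`,
together with the `r` independent edges `{1, 2}, {3, 4}, …, {2r - 1, 2r}` between its leaves.
It is meant for `2 * r + 1 ≤ t`, so that all these leaves exist. -/
def starWithEdges (t r : ℕ) : SimpleGraph (Fin t) :=
  SimpleGraph.fromRel fun a b =>
    a.val = 0 ∨ ∃ j < r, a.val = 2 * j + 1 ∧ b.val = 2 * j + 2

/-- The edge colouring `C` of a complete graph contains a rainbow copy of `G`: a copy of `G` on
which no two edges have the same colour. -/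
def HasRainbowCopy {V K W : Type*} (C : SimpleGraph.TopEdgeLabeling V K)
    (G : SimpleGraph W) : Prop :=
  ∃ f : G.Copy (⊤ : SimpleGraph V),
    Function.Injective fun e : G.edgeSet => C (f.mapEdgeSet e)

/-- The edge colouring `C` of a complete graph contains a monochromatic copy of `H`. -/
def HasMonochromaticCopy {V K W : Type*} (C : SimpleGraph.TopEdgeLabeling V K)
    (H : SimpleGraph W) : Prop :=
  ∃ i : K, H.IsContained (C.labelGraph i)

/-- The orders `n` such that every colouring of the edges of `K_n` with colours from a fixed set
of `k` colours contains a rainbow copy of `G` or a monochromatic copy of `H`. -/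
def gallaiRamseySet {W W' : Type*} (k : ℕ) (G : SimpleGraph W) (H : SimpleGraph W') : Set ℕ :=
  {n | ∀ C : SimpleGraph.TopEdgeLabeling (Fin n) (Fin k),
    HasRainbowCopy C G ∨ HasMonochromaticCopy C H}

/-- The `k`-coloured Gallai-Ramsey number `gr_k(G : H)`, the least element of
`gallaiRamseySet k G H` (whenever that set is nonempty). -/
noncomputable def gallaiRamseyNumber {W W' : Type*} (k : ℕ) (G : SimpleGraph W)
    (H : SimpleGraph W') : ℕ :=
  sInf (gallaiRamseySet k G H)

end GallaiRamsey

/-! Write `s = r - 1`. The upper bound is an induction on the number of colours in steps of two,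
driven by Gallai partitions: a colouring without rainbow triangles splits the vertices into modules
with at most two colours `a`, `b` between them (`exists_gallai_partition`).

The basic estimate is `card_lt_of_forall_colorFree`. If a vertex sees a set `Y` in colour `i` and
there is no monochromatic star, then either `Y` has fewer than `t - 1` vertices or it has no `s + 1`
disjoint edges of colour `i`. In the latter case, deleting at most `2 * s` vertices removes colour
`i` from `Y`, and a bound for fewer colours applies.

Let `m` be the bound with two colours fewer. If some part sees everything outside it in one colour,
the vertex set is bipartite in that colour, and the bound with one colour fewer suffices. Otherwise
every part sees both `a` and `b`. Fix a vertex `x`. Its part loses `a` and then `b`, so has fewer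
than `m + 4 * s` vertices; outside it, `x` has fewer than `2 * m + 6 * s` neighbours in each of `a`
and `b` (`card_neighbors_lt`). Adding up gives the recursion `5 * m + 16 * s` of `upperBound`.

For the lower bound, start with a one-coloured complete graph on `t - 1` vertices. Repeatedly
substitute it into the 2-coloured `K_5` without monochromatic triangles, using two new colours each
time; for even `k`, finally join two copies by one more colour. New colours contain no triangle and
old colours stay inside a copy (`IsStarFree.blowUp`). -/

namespace GallaiRamsey

/-! ### Gallai partitions -/

/-- No three vertices span a triangle of the edge colouring `c` with three distinct colours. -/
def RainbowTriangleFree {V K : Type*} (c : V → V → K) : Prop :=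
  ∀ x y z, x ≠ y → y ≠ z → x ≠ z → c x y = c y z ∨ c y z = c x z ∨ c x y = c x z

/-- The edges of colour `a` connect the vertices of `S`: every cut of `S` is crossed by one. -/
def ConnectedOn {V K : Type*} [DecidableEq V] (c : V → V → K) (S : Finset V) (a : K) : Prop :=
  ∀ T ⊆ S, T.Nonempty → T ≠ S → ∃ x ∈ T, ∃ y ∈ S \ T, c x y = a

/-- If two edges of a triangle do not have the colour of the third, they have the same colour. -/
theorem RainbowTriangleFree.color_eq {V K : Type*} {c : V → V → K}
    (hr : RainbowTriangleFree c) {x y z : V} (hzx : x ≠ z) (hzy : y ≠ z)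
    (hx : c x z ≠ c x y) (hy : c y z ≠ c x y) : c x z = c y z := by
  by_cases hxy : x = y
  · rw [hxy]
  · rcases hr x y z hxy hzy hzx with h | h | h
    · exact absurd h.symm hy
    · exact h.symm
    · exact absurd h.symm hx

section

variable {V K : Type*} [DecidableEq V] {c : V → V → K}

/-- Suppose deleting `v` disconnects colour `a`. Its components are modules, and each contains an
`a`-neighbour of `v`. Hence a vertex that `v` sees in colour `e ≠ a` sends only `e` to the other
components. Taking `e = b` and `e = d`, which `v` sees because these colours are connected on `S`,
is contradictory. -/
theorem connectedOn_erase (hs : ∀ x y, c x y = c y x) (hr : RainbowTriangleFree c)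
    {S : Finset V} {v : V} (hv : v ∈ S) {a b d : K} (hab : a ≠ b) (had : a ≠ d) (hbd : b ≠ d)
    (ha : ConnectedOn c S a) (hb : ConnectedOn c S b) (hd : ConnectedOn c S d)
    (hS : 2 ≤ S.card) : ConnectedOn c (S.erase v) a := by
  classical
  by_contra hcon
  unfold ConnectedOn at hcon
  push Not at hcon
  obtain ⟨T, hTS, ⟨t₁, ht₁⟩, hTne, hT⟩ := hcon
  obtain ⟨t₂, ht₂, ht₂T⟩ : ∃ x ∈ S.erase v, x ∉ T := by
    by_contra h
    push Not at h
    exact hTne (Finset.Subset.antisymm hTS h)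
  -- `E` is reachability by `a`-edges avoiding `v`; `T` is a union of its components.
  let R : V → V → Prop := fun x y => x ∈ S.erase v ∧ y ∈ S.erase v ∧ c x y = a
  let E := Relation.ReflTransGen R
  have hRsymm : Std.Symm R := ⟨fun x y h => ⟨h.2.1, h.1, (hs y x).trans h.2.2⟩⟩
  have hE : ∀ {x y}, E x y → E y x := fun h => (Relation.ReflTransGen.stdSymm (r := R)).symm _ _ h
  have hT' : ∀ {x y}, E x y → (x ∈ T ↔ y ∈ T) := by
    intro x y h
    induction h with
    | refl => rfl
    | @tail y z _ hz ih =>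
      rw [ih]
      constructor
      · intro hy
        by_contra hz'
        exact hT y hy z (Finset.mem_sdiff.2 ⟨hz.2.1, hz'⟩) hz.2.2
      · intro hz'
        by_contra hy
        exact hT z hz' y (Finset.mem_sdiff.2 ⟨hz.1, hy⟩) ((hs z y).trans hz.2.2)
  have hmem : ∀ {x y}, E x y → x ∈ S.erase v → y ∈ S.erase v := by
    intro x y h hx
    induction h with
    | refl => exact hx
    | tail _ hz _ => exact hz.2.1
  have hhom : ∀ {x y z}, E x y → x ∈ S.erase v → z ∈ S.erase v → ¬ E x z → c x z = c y z := by
    intro x y z h hx hz hxz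
    have hne : ∀ {y}, E x y → y ≠ z ∧ c y z ≠ a := fun {y} hy =>
      ⟨fun h => hxz (h ▸ hy), fun h => hxz (hy.tail ⟨hmem hy hx, hz, h⟩)⟩
    induction h with
    | refl => rfl
    | @tail y w hy hw ih =>
      have h1 := hne hy
      have h2 := hne (hy.tail hw)
      rw [← hw.2.2] at h1 h2
      exact ih.trans (hr.color_eq h1.1 h2.1 h1.2 h2.2)
  have hred : ∀ w ∈ S.erase v, ∃ x ∈ S.erase v, E w x ∧ c v x = a := by
    intro w hw
    obtain ⟨x, hx, y, hy, hxy⟩ := ha ((S.erase v).filter (E w))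
      ((Finset.filter_subset _ _).trans (Finset.erase_subset _ _))
      ⟨w, Finset.mem_filter.2 ⟨hw, Relation.ReflTransGen.refl⟩⟩
      (by
        intro h
        rw [← h] at hv
        simp at hv)
    rw [Finset.mem_filter] at hx
    rw [Finset.mem_sdiff, Finset.mem_filter] at hy
    have hyv : y = v := by
      by_contra hyv
      have hyS : y ∈ S.erase v := Finset.mem_erase.2 ⟨hyv, hy.1⟩
      exact hy.2 ⟨hyS, hx.2.tail ⟨hx.1, hyS, hxy⟩⟩
    subst hyv
    exact ⟨x, hx.1, hx.2, (hs _ _).trans hxy⟩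
  have hout : ∀ {e : K} {u w : V}, a ≠ e → u ∈ S.erase v → w ∈ S.erase v → c v u = e → ¬ E u w →
      c u w = e := by
    intro e u w hae hu hw huv huw
    obtain ⟨x, hx, hwx, hvx⟩ := hred w hw
    have hux : ¬ E u x := fun h => huw (h.trans (hE hwx))
    have h1 : c u x ≠ a := fun h => hux (Relation.ReflTransGen.single ⟨hu, hx, h⟩)
    have h2 : u ≠ x := fun h => hux (h ▸ Relation.ReflTransGen.refl)
    have h3 : c w u = c x u := hhom hwx hw hu (fun h => huw (hE h))
    rw [hs, h3, hs]
    -- In the triangle `v u x`, `v x` has colour `a`, `v u` has colour `e ≠ a`, and `u x` avoids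
    -- `a`, so `u x` must have colour `e`.
    rcases hr v u x (Finset.ne_of_mem_erase hu).symm h2 (Finset.ne_of_mem_erase hx).symm
      with h | h | h
    · rw [← h, huv]
    · exact absurd (h.trans hvx) h1
    · exact absurd (hvx.symm.trans (h.symm.trans huv)) hae
  have hv1 : ∀ {e : K}, ConnectedOn c S e → ∃ u ∈ S.erase v, c v u = e := by
    intro e he
    obtain ⟨x, hx, y, hy, hxy⟩ := he {v} (by simpa using hv) ⟨v, by simp⟩
      (by intro h; rw [← h] at hS; simp at hS)
    rw [Finset.mem_singleton] at hx
    subst hx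
    rw [Finset.sdiff_singleton_eq_erase] at hy
    exact ⟨y, hy, hxy⟩
  obtain ⟨u, hu, huv⟩ := hv1 hb
  obtain ⟨u', hu', huv'⟩ := hv1 hd
  by_cases huu : E u u'
  · obtain ⟨w, hw, huw⟩ : ∃ w ∈ S.erase v, ¬ E u w := by
      by_cases huT : u ∈ T
      · exact ⟨t₂, ht₂, fun h => ht₂T ((hT' h).1 huT)⟩
      · exact ⟨t₁, hTS ht₁, fun h => huT ((hT' h).2 ht₁)⟩
    have h1 := hout hab hu hw huv huw
    have h2 := hout had hu' hw huv' (fun h => huw (huu.trans h))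
    exact hbd (h1.symm.trans ((hhom huu hu hw huw).trans h2))
  · have h1 := hout hab hu hu' huv huu
    have h2 := hout had hu' hu huv' (fun h => huu (hE h))
    exact hbd (h1.symm.trans ((hs _ _).trans h2))

/-- In an edge colouring without rainbow triangles, no three colours are all connected. -/
theorem not_connectedOn_three (hs : ∀ x y, c x y = c y x) (hr : RainbowTriangleFree c)
    {a b d : K} (hab : a ≠ b) (had : a ≠ d) (hbd : b ≠ d) (S : Finset V) (hS : 2 ≤ S.card)
    (ha : ConnectedOn c S a) (hb : ConnectedOn c S b) (hd : ConnectedOn c S d) : False := by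
  induction hn : S.card generalizing S with
  | zero => omega
  | succ n ih =>
    obtain ⟨v, hv⟩ : S.Nonempty := Finset.card_pos.1 (by omega)
    have hcard : (S.erase v).card = n := by rw [Finset.card_erase_of_mem hv]; omega
    by_cases hn2 : 2 ≤ n
    · exact ih (S.erase v) (by omega)
        (connectedOn_erase hs hr hv hab had hbd ha hb hd hS)
        (connectedOn_erase hs hr hv hab.symm hbd had hb ha hd hS)
        (connectedOn_erase hs hr hv had.symm hbd.symm hab hd ha hb hS) hcard
    · obtain ⟨w, hw⟩ := Finset.card_eq_one.1 (show (S.erase v).card = 1 by omega)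
      have hv1 : ∀ {e : K}, ConnectedOn c S e → c v w = e := by
        intro e he
        obtain ⟨x, hx, y, hy, hxy⟩ := he {v} (by simpa using hv) ⟨v, by simp⟩
          (by intro h; rw [← h] at hS; simp at hS)
        rw [Finset.mem_singleton] at hx
        subst hx
        rw [Finset.sdiff_singleton_eq_erase, hw, Finset.mem_singleton] at hy
        rw [← hy, hxy]
      exact hab ((hv1 ha).symm.trans (hv1 hb))

end

/-- The classes of `E` are modules of the edge colouring `c`: a vertex outside a class sees all its
vertices in the same colour. -/
def IsHomogeneous {V K : Type*} (c : V → V → K) (E : Setoid V) : Prop :=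
  ∀ x y z, E x y → ¬ E x z → c x z = c y z

/-- In a coarsest nontrivial homogeneous partition, the colours between the classes are connected
on the quotient. -/
theorem connectedOn_quotient {V K : Type*} {c : V → V → K} (hs : ∀ x y, c x y = c y x)
    (hr : RainbowTriangleFree c) {E : Setoid V}
    [Fintype (Quotient E)] [DecidableEq (Quotient E)]
    (hmax : Maximal (fun E : Setoid V => E ≠ ⊤ ∧ IsHomogeneous c E) E)
    {x₀ y₀ : V} (h₀ : ¬ E x₀ y₀) :
    ConnectedOn (fun p q : Quotient E => c p.out q.out) Finset.univ (c x₀ y₀) := by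
  intro T _ hT hTne
  by_contra hcon
  push Not at hcon
  obtain ⟨q₂, hq₂⟩ : ∃ q, q ∉ T := by
    by_contra h
    push Not at h
    exact hTne (Finset.eq_univ_iff_forall.2 h)
  obtain ⟨q₁, hq₁⟩ := hT
  have hE := hmax.prop.2
  have hout : ∀ x y, ¬ E x y → c x y = c (Quotient.mk E x).out (Quotient.mk E y).out := by
    intro x y hxy
    have hx : E x (Quotient.mk E x).out := E.symm (Quotient.mk_out x)
    have hy : E y (Quotient.mk E y).out := E.symm (Quotient.mk_out y)
    rw [hE x _ y hx hxy, hs, hE y _ _ hy (fun h => hxy (E.trans hx (E.symm h))), hs]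
  -- If the colour is not connected on the quotient, merging the classes along it gives a coarser
  -- partition that is still homogeneous and still nontrivial, against maximality.
  let R : V → V → Prop := fun x y => E x y ∨ (¬ E x y ∧ c x y = c x₀ y₀)
  have hRsymm : Std.Symm R := ⟨by
    rintro x y (h | h)
    · exact Or.inl (E.symm h)
    · exact Or.inr ⟨fun h' => h.1 (E.symm h'), (hs y x).trans h.2⟩⟩
  let E' : Setoid V := ⟨Relation.ReflTransGen R, fun _ => Relation.ReflTransGen.refl,
    fun h => (Relation.ReflTransGen.stdSymm (r := R)).symm _ _ h, fun h h' => h.trans h'⟩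
  have hle : E ≤ E' := fun _ _ h => Relation.ReflTransGen.single (Or.inl h)
  have hT' : ∀ {x y}, E' x y → (Quotient.mk E x ∈ T ↔ Quotient.mk E y ∈ T) := by
    intro x y h
    replace h : Relation.ReflTransGen R x y := h
    induction h with
    | refl => rfl
    | @tail y z _ hz ih =>
      refine ih.trans ?_
      rcases hz with hz | ⟨hz, hzc⟩
      · rw [Quotient.sound hz]
      · constructor
        · intro hy
          by_contra hz'
          exact hcon _ hy _ (by simpa using hz') ((hout y z hz).symm.trans hzc)
        · intro hz'
          by_contra hy
          refine hcon _ hz' _ (by simpa using hy) ?_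
          rw [hs]
          exact (hout y z hz).symm.trans hzc
  have hP : E' ≠ ⊤ ∧ IsHomogeneous c E' := by
    constructor
    · intro h
      have h12 : E' q₁.out q₂.out := by rw [h]; trivial
      have := (hT' h12).1 (by simpa using hq₁)
      exact hq₂ (by simpa using this)
    · intro x y z hxy hxz
      have hne : ∀ {y}, E' x y → ¬ E y z ∧ c y z ≠ c x₀ y₀ := by
        intro y hy
        have h1 : ¬ E y z := fun h => hxz (E'.trans hy (hle h))
        exact ⟨h1, fun h => hxz (E'.trans hy (Relation.ReflTransGen.single (Or.inr ⟨h1, h⟩)))⟩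
      replace hxy : Relation.ReflTransGen R x y := hxy
      induction hxy with
      | refl => rfl
      | @tail y w hy hw ih =>
        have h1 := hne hy
        have h2 := hne (hy.tail hw)
        refine ih.trans ?_
        rcases hw with hw | ⟨-, hw⟩
        · exact hE y w z hw h1.1
        · rw [← hw] at h1 h2
          exact hr.color_eq (fun h => h1.1 (h ▸ E.refl _)) (fun h => h2.1 (h ▸ E.refl _)) h1.2 h2.2
  have hle' := hmax.le_of_ge hP hle
  exact h₀ (hle' (Relation.ReflTransGen.single (Or.inr ⟨h₀, rfl⟩)))

/-- The **Gallai partition theorem**: a finite complete graph on at least two vertices, coloured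
without rainbow triangles, has a nontrivial partition into modules such that at most two colours
occur between them. -/
theorem exists_gallai_partition {V K : Type*} [Finite V] [Nontrivial V] {c : V → V → K}
    (hs : ∀ x y, c x y = c y x) (hr : RainbowTriangleFree c) :
    ∃ E : Setoid V, E ≠ ⊤ ∧ IsHomogeneous c E ∧
      ∃ a b, ∀ x y, ¬ E x y → c x y = a ∨ c x y = b := by
  classical
  have : Finite (Setoid V) :=
    Finite.of_injective (fun E : Setoid V => fun x y => E x y) fun E E' h =>
      Setoid.ext fun x y => iff_of_eq (congrFun (congrFun h x) y)
  have hbot : (⊥ : Setoid V) ≠ ⊤ ∧ IsHomogeneous c ⊥ := by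
    constructor
    · obtain ⟨x, y, hxy⟩ := exists_pair_ne V
      intro h
      exact hxy (Setoid.eq_top_iff.1 h x y)
    rintro x y z h -
    have h' : x = y := h
    rw [h']
  obtain ⟨E, -, hmax⟩ := Finite.exists_le_maximal
    (p := fun E : Setoid V => E ≠ ⊤ ∧ IsHomogeneous c E) hbot
  refine ⟨E, hmax.prop.1, hmax.prop.2, ?_⟩
  by_contra! hcon
  obtain ⟨x₁, y₁, h₁⟩ : ∃ x y, ¬ E x y := by
    by_contra! h
    exact hmax.prop.1 (Setoid.eq_top_iff.2 h)
  -- Excluding one colour, then two, produces three distinct colours between classes, all connected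
  -- on the quotient.
  obtain ⟨x₂, y₂, h₂, h₂₁, -⟩ := hcon (c x₁ y₁) (c x₁ y₁)
  obtain ⟨x₃, y₃, h₃, h₃₁, h₃₂⟩ := hcon (c x₁ y₁) (c x₂ y₂)
  have : Fintype (Quotient E) := Fintype.ofFinite _
  refine not_connectedOn_three (c := fun p q : Quotient E => c p.out q.out) (fun _ _ => hs _ _)
    ?_ h₂₁.symm h₃₁.symm h₃₂.symm Finset.univ ?_ (connectedOn_quotient hs hr hmax h₁)
    (connectedOn_quotient hs hr hmax h₂) (connectedOn_quotient hs hr hmax h₃)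
  · have hinj := Quotient.out_injective (s := E)
    exact fun x y z hxy hyz hxz => hr _ _ _ (hinj.ne hxy) (hinj.ne hyz) (hinj.ne hxz)
  · rw [Finset.card_univ, Nat.succ_le_iff, Fintype.one_lt_card_iff]
    exact ⟨Quotient.mk E x₁, Quotient.mk E y₁, fun h => h₁ (Quotient.exact h)⟩

/-- The Gallai partition theorem for a finite set of vertices, the parts being the fibres of a
map. -/
theorem exists_gallai_partition_finset {V K : Type*} {c : V → V → K}
    (hs : ∀ x y, c x y = c y x) (hr : RainbowTriangleFree c) {T : Finset V} (hT : 2 ≤ T.card) :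
    ∃ p : V → V, (∃ x ∈ T, ∃ y ∈ T, p x ≠ p y) ∧
      (∀ x ∈ T, ∀ y ∈ T, ∀ z ∈ T, p x = p y → p x ≠ p z → c x z = c y z) ∧
      ∃ a b, ∀ x ∈ T, ∀ y ∈ T, p x ≠ p y → c x y = a ∨ c x y = b := by
  classical
  have : Nontrivial T := Fintype.one_lt_card_iff_nontrivial.1 (by rw [Fintype.card_coe]; omega)
  obtain ⟨E, hE, hhom, a, b, hab⟩ := exists_gallai_partition (V := T) (c := fun x y => c x y)
    (fun _ _ => hs _ _) fun x y z hxy hyz hxz => hr _ _ _ (Subtype.coe_injective.ne hxy)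
      (Subtype.coe_injective.ne hyz) (Subtype.coe_injective.ne hxz)
  obtain ⟨x₁, y₁, h₁⟩ : ∃ x y, ¬ E x y := by
    by_contra! h
    exact hE (Setoid.eq_top_iff.2 h)
  let p : V → V := fun x => if h : x ∈ T then (Quotient.mk E ⟨x, h⟩).out.val else x
  have hp : ∀ x y : T, p x = p y ↔ E x y := by
    intro x y
    simp only [p, x.2, y.2, dif_pos, Subtype.coe_inj, Quotient.out_inj]
    exact Quotient.eq
  refine ⟨p, ⟨x₁, x₁.2, y₁, y₁.2, fun h => h₁ ((hp _ _).1 h)⟩, ?_, a, b, ?_⟩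
  · intro x hx y hy z hz hxy hxz
    exact hhom ⟨x, hx⟩ ⟨y, hy⟩ ⟨z, hz⟩ ((hp _ _).1 hxy) fun h => hxz ((hp ⟨x, hx⟩ ⟨z, hz⟩).2 h)
  · intro x hx y hy hxy
    exact hab ⟨x, hx⟩ ⟨y, hy⟩ fun h => hxy ((hp ⟨x, hx⟩ ⟨y, hy⟩).2 h)

/-! ### Monochromatic matchings and stars -/

section

variable {V K : Type*} {c : V → V → K}

/-- No edge inside `N` has colour `i`. -/
def ColorFree (c : V → V → K) (i : K) (N : Finset V) : Prop :=
  ∀ x ∈ N, ∀ y ∈ N, x ≠ y → c x y ≠ i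

/-- The edges inside `T` have colours from `P`. -/
def ColoredBy (c : V → V → K) (P : Finset K) (T : Finset V) : Prop :=
  ∀ x ∈ T, ∀ y ∈ T, x ≠ y → c x y ∈ P

theorem ColoredBy.mono {P : Finset K} {T T' : Finset V} (h : ColoredBy c P T) (hT : T' ⊆ T) :
    ColoredBy c P T' :=
  fun x hx y hy hxy => h x (hT hx) y (hT hy) hxy

theorem ColorFree.mono {i : K} {T T' : Finset V} (h : ColorFree c i T) (hT : T' ⊆ T) :
    ColorFree c i T' :=
  fun x hx y hy hxy => h x (hT hx) y (hT hy) hxy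

theorem ColoredBy.erase [DecidableEq K] {P : Finset K} {T : Finset V} {i : K}
    (h : ColoredBy c P T) (hi : ColorFree c i T) : ColoredBy c (P.erase i) T :=
  fun x hx y hy hxy => Finset.mem_erase.2 ⟨hi x hx y hy hxy, h x hx y hy hxy⟩

end

section

variable {V K : Type*} [DecidableEq V]

/-- The set `N` contains `r` disjoint edges of colour `i`. -/
def HasMatching (c : V → V → K) (i : K) : ℕ → Finset V → Prop
  | 0, _ => True
  | r + 1, N => ∃ x ∈ N, ∃ y ∈ N, x ≠ y ∧ c x y = i ∧ HasMatching c i r ((N.erase x).erase y)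

/-- There is a vertex with at least `t - 1` neighbours in one colour, and these neighbours contain
`r` disjoint edges of the same colour. -/
def HasStar (c : V → V → K) (t r : ℕ) : Prop :=
  ∃ i v N, v ∉ N ∧ (∀ x ∈ N, c v x = i) ∧ t ≤ N.card + 1 ∧ HasMatching c i r N

variable {c : V → V → K}

/-- Greedy choice: each chosen edge costs two vertices, and stopping before `s + 1` edges means at
most `s` were removed. -/
theorem hasMatching_or_exists_colorFree (c : V → V → K) (i : K) (s : ℕ) (N : Finset V) :
    HasMatching c i (s + 1) N ∨ ∃ N' ⊆ N, ColorFree c i N' ∧ N.card ≤ N'.card + 2 * s := by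
  induction s generalizing N with
  | zero =>
    by_cases h : ColorFree c i N
    · exact Or.inr ⟨N, subset_rfl, h, le_rfl⟩
    · unfold ColorFree at h
      push Not at h
      obtain ⟨x, hx, y, hy, hxy, h⟩ := h
      exact Or.inl ⟨x, hx, y, hy, hxy, h, trivial⟩
  | succ s ih =>
    by_cases h : ColorFree c i N
    · exact Or.inr ⟨N, subset_rfl, h, by omega⟩
    · unfold ColorFree at h
      push Not at h
      obtain ⟨x, hx, y, hy, hxy, h⟩ := h
      rcases ih ((N.erase x).erase y) with h' | ⟨N', hN', hf, hc⟩
      · exact Or.inl ⟨x, hx, y, hy, hxy, h, h'⟩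
      · refine Or.inr ⟨N', hN'.trans ((Finset.erase_subset _ _).trans (Finset.erase_subset _ _)),
          hf, ?_⟩
        rw [Finset.card_erase_of_mem (Finset.mem_erase.2 ⟨hxy.symm, hy⟩),
          Finset.card_erase_of_mem hx] at hc
        omega

/-- A matching of `r` edges, listed as the pairs of consecutive values of an injection. -/
theorem HasMatching.exists_injOn [Nonempty V] {i : K} {r : ℕ} {N : Finset V} (h : HasMatching c i r N) :
    ∃ e : ℕ → V, (∀ m < 2 * r, e m ∈ N) ∧ (∀ m < 2 * r, ∀ n < 2 * r, e m = e n → m = n) ∧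
      ∀ j < r, c (e (2 * j)) (e (2 * j + 1)) = i := by
  induction r generalizing N with
  | zero => exact ⟨fun _ => Classical.arbitrary V, by simp, by simp, by simp⟩
  | succ r ih =>
    obtain ⟨x, hx, y, hy, hxy, hc, h⟩ := h
    obtain ⟨e, he, hinj, hce⟩ := ih h
    have hex : ∀ m < 2 * r, e m ∈ N ∧ e m ≠ x ∧ e m ≠ y := by
      intro m hm
      have := he m hm
      simp only [Finset.mem_erase] at this
      tauto
    refine ⟨fun m => if m < 2 * r then e m else if m = 2 * r then x else y, ?_, ?_, ?_⟩
    · intro m _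
      dsimp only
      split_ifs with h1 h2
      · exact (hex m h1).1
      · exact hx
      · exact hy
    · intro m hm n hn hmn
      have h1 := hex m
      have h2 := hex n
      have h3 := hinj m
      grind
    · intro j hj
      by_cases hjr : j = r
      · subst hjr
        simpa using hc
      · have h1 : 2 * j < 2 * r := by omega
        have h2 : 2 * j + 1 < 2 * r := by omega
        simp only [h1, h2, if_true]
        exact hce j (by omega)

/-- If a vertex sees `Y` in colour `i` and there is no monochromatic star, then `Y` is not much
larger than its largest subset without colour `i`. -/
theorem card_lt_of_forall_colorFree {t s m : ℕ} (hc : ¬ HasStar c t (s + 1)) {i : K} {u : V}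
    {Y : Finset V} (hu : u ∉ Y) (huY : ∀ y ∈ Y, c u y = i) (htm : t ≤ m)
    (hm : ∀ Y' ⊆ Y, ColorFree c i Y' → Y'.card < m) : Y.card < m + 2 * s := by
  by_cases hY : t ≤ Y.card + 1
  · rcases hasMatching_or_exists_colorFree c i s Y with h | ⟨Y', hY', hf, hle⟩
    · exact absurd ⟨i, u, Y, hu, huY, hY, h⟩ hc
    · have := hm Y' hY' hf
      omega
  · omega

/-! ### The upper bound -/

/-- The upper bound for the `k`-coloured Gallai-Ramsey number of `S_t^{s+1}`. -/
def upperBound (t s : ℕ) : ℕ → ℕ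
  -- A filler value: only positive numbers of colours occur.
  | 0 => t
  | 1 => t
  | 2 => 2 * t + 4 * s
  | k + 3 => 5 * upperBound t s (k + 1) + 16 * s

/-- This makes the bipartite case of the induction no worse than the general recursion. -/
theorem two_mul_upperBound_le (t s : ℕ) (k : ℕ) :
    2 * upperBound t s (k + 1) + 4 * s ≤ upperBound t s (k + 2) := by
  induction k using Nat.twoStepInduction with
  | zero => simp [upperBound]
  | one => simp only [upperBound]; omega
  | more k ih _ =>
    change 2 * (5 * upperBound t s (k + 1) + 16 * s) + 4 * s ≤ 5 * upperBound t s (k + 2) + 16 * s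
    omega

theorem le_upperBound (t s k : ℕ) : t ≤ upperBound t s (k + 1) := by
  induction k with
  | zero => simp [upperBound]
  | succ k ih =>
    exact (show t ≤ 2 * upperBound t s (k + 1) + 4 * s by omega).trans
      (two_mul_upperBound_le t s k)

theorem card_lt_of_one_color {t s : ℕ} (ht : 2 * s + 3 ≤ t) (hc : ¬ HasStar c t (s + 1))
    {P : Finset K} (hP : P.card = 1) {T : Finset V} (hT : ColoredBy c P T) : T.card < t := by
  by_contra! hTt
  obtain ⟨i, rfl⟩ := Finset.card_eq_one.1 hP
  obtain ⟨v, hv⟩ : T.Nonempty := Finset.card_pos.1 (by omega)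
  have hcard := Finset.card_erase_of_mem hv
  rcases hasMatching_or_exists_colorFree c i s (T.erase v) with h | ⟨N, hN, hf, hle⟩
  · refine hc ⟨i, v, T.erase v, Finset.notMem_erase _ _, fun x hx => ?_, by omega, h⟩
    rw [Finset.mem_erase] at hx
    simpa using hT v hv x hx.2 hx.1.symm
  -- Here `2 * s + 3 ≤ t` leaves at least two vertices, whose edge must have the only colour.
  · obtain ⟨x, hx, y, hy, hxy⟩ := Finset.one_lt_card.1 (show 1 < N.card by omega)
    refine hf x hx y hy hxy ?_
    simpa using hT x (Finset.mem_of_mem_erase (hN hx)) y (Finset.mem_of_mem_erase (hN hy)) hxy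

/-- A vertex has at most `t + 2 * s - 1` neighbours in each colour, since deleting that colour
leaves a one-coloured set. -/
theorem card_lt_of_two_colors {t s : ℕ} (ht : 2 * s + 3 ≤ t) (hc : ¬ HasStar c t (s + 1))
    {P : Finset K} (hP : P.card = 2) {T : Finset V} (hT : ColoredBy c P T) :
    T.card < 2 * t + 4 * s := by
  classical
  by_contra! hTt
  obtain ⟨v, hv⟩ : T.Nonempty := Finset.card_pos.1 (by omega)
  have hN : ∀ i ∈ P, ((T.erase v).filter (fun x => c v x = i)).card < t + 2 * s := by
    intro i hi
    have hsub : (T.erase v).filter (fun x => c v x = i) ⊆ T :=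
      (Finset.filter_subset _ _).trans (Finset.erase_subset _ _)
    refine card_lt_of_forall_colorFree hc (u := v) (i := i) (by simp) (by simp) le_rfl fun Y hY hf => ?_
    refine card_lt_of_one_color ht hc (P := P.erase i) ?_ ((hT.mono (hY.trans hsub)).erase hf)
    rw [Finset.card_erase_of_mem hi, hP]
  have hsum : (T.erase v).card = ∑ i ∈ P, ((T.erase v).filter (fun x => c v x = i)).card :=
    Finset.card_eq_sum_card_fiberwise fun x hx => by
      rw [Finset.mem_coe, Finset.mem_erase] at hx
      exact hT v hv x hx.2 hx.1.symm
  have hle := Finset.sum_le_card_nsmul P _ (t + 2 * s - 1) fun i hi => Nat.le_sub_one_of_lt (hN i hi)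
  rw [hP, ← hsum, Finset.card_erase_of_mem hv] at hle
  simp only [smul_eq_mul] at hle
  omega

/-- The vertex sets of a bipartition with all edges between its sides in one colour. -/
theorem card_lt_of_bipartition {t s k m : ℕ} (hc : ¬ HasStar c t (s + 1))
    (hs : ∀ x y, c x y = c y x) (htm : t ≤ m)
    (ih : ∀ P : Finset K, P.card = k → ∀ T : Finset V, ColoredBy c P T → T.card < m)
    {P : Finset K} (hP : P.card = k + 1) {A B : Finset V} (hdisj : Disjoint A B)
    (hA : A.Nonempty) (hB : B.Nonempty) (hT : ColoredBy c P (A ∪ B)) {i : K}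
    (hi : ∀ x ∈ A, ∀ y ∈ B, c x y = i) : A.card + B.card + 2 ≤ 2 * m + 4 * s := by
  classical
  obtain ⟨x, hx⟩ := hA
  obtain ⟨y, hy⟩ := hB
  have hiP : i ∈ P := by
    rw [← hi x hx y hy]
    exact hT x (by simp [hx]) y (by simp [hy]) (fun h => Finset.disjoint_left.1 hdisj hx (h ▸ hy))
  have hP' : (P.erase i).card = k := by rw [Finset.card_erase_of_mem hiP]; omega
  have h1 : A.card < m + 2 * s :=
    card_lt_of_forall_colorFree hc (u := y) (Finset.disjoint_right.1 hdisj hy)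
      (fun z hz => (hs _ _).trans (hi z hz y hy)) htm fun Y hY hf =>
        ih _ hP' Y ((hT.mono (hY.trans Finset.subset_union_left)).erase hf)
  have h2 : B.card < m + 2 * s :=
    card_lt_of_forall_colorFree hc (u := x) (Finset.disjoint_left.1 hdisj hx)
      (fun z hz => hi x hx z hz) htm fun Y hY hf =>
        ih _ hP' Y ((hT.mono (hY.trans Finset.subset_union_right)).erase hf)
  omega

/-- A Gallai partition all of whose parts see both colours `a` and `b`: the set of vertices which
one vertex sees in colour `a`, outside its own part, is small. -/
theorem card_neighbors_lt {t s m : ℕ} (hc : ¬ HasStar c t (s + 1)) (htm : t ≤ m)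
    {T : Finset V} {p : V → V} {a b : K}
    (hfree : ∀ Y ⊆ T, ColorFree c a Y → ColorFree c b Y → Y.card < m)
    (hs : ∀ x y, c x y = c y x)
    (hhom : ∀ x ∈ T, ∀ y ∈ T, ∀ z ∈ T, p x = p y → p x ≠ p z → c x z = c y z)
    (hab : ∀ x ∈ T, ∀ y ∈ T, p x ≠ p y → c x y = a ∨ c x y = b)
    (hb : ∀ x ∈ T, ∃ y ∈ T, p x ≠ p y ∧ c x y = b) {x : V} {R : Finset V}
    (hRT : R ⊆ T) (hxR : ∀ y ∈ R, p x ≠ p y ∧ c x y = a) : R.card < 2 * m + 6 * s := by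
  classical
  have key : R.card < (2 * m + 4 * s) + 2 * s := by
    refine card_lt_of_forall_colorFree hc (u := x) (fun h => (hxR x h).1 rfl)
      (fun y hy => (hxR y hy).2) (by omega) fun R' hR' hf => ?_
    rcases R'.eq_empty_or_nonempty with rfl | ⟨y, hy⟩
    · have := hfree ∅ (by simp) (by simp [ColorFree]) (by simp [ColorFree])
      simp only [Finset.card_empty] at this ⊢
      omega
    have hR'T := hR'.trans hRT
    have hyT := hR'T hy
    obtain ⟨u, hu, hyu, hcu⟩ := hb y hyT
    -- The part of `y` is a module, so an outside `b`-neighbour `u` of `y` sees all of it in colour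
    -- `b`.
    have h1 : (R'.filter (fun z => p y = p z)).card < m + 2 * s := by
      refine card_lt_of_forall_colorFree hc (u := u) (i := b)
        (fun h => hyu (Finset.mem_filter.1 h).2) ?_ htm fun Y hY hfY => ?_
      · intro z hz
        rw [Finset.mem_filter] at hz
        rw [hs, ← hhom y hyT z (hR'T hz.1) u hu hz.2 hyu, hcu]
      · have hY' := hY.trans (Finset.filter_subset _ _)
        exact hfree Y (hY'.trans hR'T) (hf.mono hY') hfY
    -- Colour `a` is absent from `R'`, so `y` sees the rest of `R'`, outside its part, in colour
    -- `b`.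
    have h2 : (R'.filter (fun z => ¬ p y = p z)).card < m + 2 * s := by
      refine card_lt_of_forall_colorFree hc (u := y) (i := b)
        (fun h => (Finset.mem_filter.1 h).2 rfl) ?_ htm fun Y hY hfY => ?_
      · intro z hz
        rw [Finset.mem_filter] at hz
        exact (hab y hyT z (hR'T hz.1) hz.2).resolve_left
          (hf y hy z hz.1 fun h => hz.2 (congrArg p h))
      · have hY' := hY.trans (Finset.filter_subset _ _)
        exact hfree Y (hY'.trans hR'T) (hf.mono hY') hfY
    have h3 := Finset.card_filter_add_card_filter_not (s := R') (fun z => p y = p z)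
    omega
  omega

theorem card_lt_upperBound {t s : ℕ} (ht : 2 * s + 3 ≤ t) (hc : ¬ HasStar c t (s + 1))
    (hs : ∀ x y, c x y = c y x) (hr : RainbowTriangleFree c) (k : ℕ) :
    ∀ P : Finset K, P.card = k + 1 → ∀ T : Finset V, ColoredBy c P T →
      T.card < upperBound t s (k + 1) := by
  classical
  induction k using Nat.twoStepInduction with
  | zero => exact fun P hP T hT => card_lt_of_one_color ht hc hP hT
  | one => exact fun P hP T hT => card_lt_of_two_colors ht hc hP hT
  | more k ih₁ ih₂ =>
    intro P hP T hT
    by_contra! hcard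
    change upperBound t s (k + 3) ≤ T.card at hcard
    have hf₁ := le_upperBound t s k
    have hf₂ : t ≤ upperBound t s (k + 2) := le_upperBound t s (k + 1)
    have hf₃ : 2 * upperBound t s (k + 2) + 4 * s ≤ upperBound t s (k + 3) :=
      two_mul_upperBound_le t s (k + 1)
    have hf₄ : upperBound t s (k + 3) = 5 * upperBound t s (k + 1) + 16 * s := rfl
    obtain ⟨p, ⟨x₁, hx₁, y₁, hy₁, hne⟩, hhom, a, b, hab⟩ :=
      exists_gallai_partition_finset hs hr (T := T) (by omega)
    -- Otherwise the part of `x` and its complement form a bipartition in one colour, and `T` is too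
    -- small by `hf₃`.
    have hbip : ∀ x ∈ T, ∀ i, ∃ y ∈ T, p x ≠ p y ∧ c x y ≠ i := by
      intro x hx i
      by_contra! hi
      have hunion := Finset.filter_union_filter_not_eq (fun y => p x = p y) T
      have h := card_lt_of_bipartition hc hs hf₂ ih₂ hP (i := i)
        (Finset.disjoint_filter_filter_not T T (fun y => p x = p y)) ⟨x, by simp [hx]⟩
        (by
          by_cases hx₁' : p x = p x₁
          · exact ⟨y₁, by simp [hy₁, hx₁', hne]⟩
          · exact ⟨x₁, by simp [hx₁, hx₁']⟩)
        (by rwa [hunion])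
        (by
          intro y hy z hz
          rw [Finset.mem_filter] at hy hz
          rw [← hhom x hx y hy.1 z hz.1 hy.2 hz.2, hi z hz.1 hz.2])
      rw [Finset.card_filter_add_card_filter_not] at h
      omega
    have ha : ∀ x ∈ T, ∃ y ∈ T, p x ≠ p y ∧ c x y = a := by
      intro x hx
      obtain ⟨y, hy, hxy, h⟩ := hbip x hx b
      exact ⟨y, hy, hxy, (hab x hx y hy hxy).resolve_right h⟩
    have hb : ∀ x ∈ T, ∃ y ∈ T, p x ≠ p y ∧ c x y = b := by
      intro x hx
      obtain ⟨y, hy, hxy, h⟩ := hbip x hx a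
      exact ⟨y, hy, hxy, (hab x hx y hy hxy).resolve_left h⟩
    obtain ⟨ya, hya, hxya, hca⟩ := ha x₁ hx₁
    obtain ⟨yb, hyb, hxyb, hcb⟩ := hb x₁ hx₁
    have hne_ab : a ≠ b := by
      rintro rfl
      obtain ⟨y, hy, hxy, h⟩ := hbip x₁ hx₁ a
      exact (hab x₁ hx₁ y hy hxy).elim h h
    have haP : a ∈ P := hca ▸ hT x₁ hx₁ ya hya fun h => hxya (congrArg p h)
    have hbP : b ∈ P := hcb ▸ hT x₁ hx₁ yb hyb fun h => hxyb (congrArg p h)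
    have hP' : ((P.erase a).erase b).card = k + 1 := by
      rw [Finset.card_erase_of_mem (Finset.mem_erase.2 ⟨hne_ab.symm, hbP⟩),
        Finset.card_erase_of_mem haP]
      omega
    have hfree : ∀ Y ⊆ T, ColorFree c a Y → ColorFree c b Y → Y.card < upperBound t s (k + 1) :=
      fun Y hY hYa hYb => ih₁ _ hP' Y (((hT.mono hY).erase hYa).erase hYb)
    -- The basic estimate is used twice, nested: first `a` is removed using `ya`, then `b` using
    -- `yb`.
    have hA : (T.filter (fun y => p x₁ = p y)).card < upperBound t s (k + 1) + 2 * s + 2 * s := by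
      refine card_lt_of_forall_colorFree hc (u := ya) (i := a)
        (fun h => hxya (Finset.mem_filter.1 h).2) ?_ (by omega) fun Y hY hYa => ?_
      · intro z hz
        rw [Finset.mem_filter] at hz
        rw [hs, ← hhom x₁ hx₁ z hz.1 ya hya hz.2 hxya, hca]
      refine card_lt_of_forall_colorFree hc (u := yb) (i := b)
        (fun h => hxyb (Finset.mem_filter.1 (hY h)).2) ?_ hf₁ fun Y' hY' hYb => ?_
      · intro z hz
        replace hz := Finset.mem_filter.1 (hY hz)
        rw [hs, ← hhom x₁ hx₁ z hz.1 yb hyb hz.2 hxyb, hcb]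
      · exact hfree Y' (hY'.trans (hY.trans (Finset.filter_subset _ _))) (hYa.mono hY') hYb
    have hR := card_neighbors_lt hc hf₁ hfree hs hhom hab hb (x := x₁)
      (R := T.filter (fun y => p x₁ ≠ p y ∧ c x₁ y = a)) (Finset.filter_subset _ _)
      (fun y hy => (Finset.mem_filter.1 hy).2)
    have hB := card_neighbors_lt hc hf₁ (fun Y hY h h' => hfree Y hY h' h) hs hhom
      (fun x hx y hy hxy => (hab x hx y hy hxy).symm) ha (x := x₁)
      (R := T.filter (fun y => p x₁ ≠ p y ∧ c x₁ y = b)) (Finset.filter_subset _ _)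
      (fun y hy => (Finset.mem_filter.1 hy).2)
    have hcover : T ⊆ T.filter (fun y => p x₁ = p y) ∪
        (T.filter (fun y => p x₁ ≠ p y ∧ c x₁ y = a) ∪
          T.filter (fun y => p x₁ ≠ p y ∧ c x₁ y = b)) := by
      intro y hy
      have := hab x₁ hx₁ y hy
      simp only [Finset.mem_union, Finset.mem_filter, hy, true_and]
      tauto
    have h1 := Finset.card_le_card hcover
    have h2 := h1.trans (Finset.card_union_le _ _)
    have h3 := Finset.card_union_le (T.filter (fun y => p x₁ ≠ p y ∧ c x₁ y = a))
      (T.filter (fun y => p x₁ ≠ p y ∧ c x₁ y = b))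
    -- With `m = upperBound t s (k + 1)`, the three sets contribute less than `(m + 4 * s) + 2 * (2
    -- * m + 6 * s) = 5 * m + 16 * s`.
    omega

end

/-! ### Translation to edge labellings -/

theorem hasRainbowCopy_of_ne {V K : Type*} {C : SimpleGraph.TopEdgeLabeling V K} {x y z : V}
    (hxy : x ≠ y) (hyz : y ≠ z) (hxz : x ≠ z) (h1 : C.get x y hxy ≠ C.get y z hyz)
    (h2 : C.get y z hyz ≠ C.get x z hxz) (h3 : C.get x y hxy ≠ C.get x z hxz) :
    HasRainbowCopy C (⊤ : SimpleGraph (Fin 3)) := by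
  have hinj : Function.Injective ![x, y, z] := by
    intro i j h
    fin_cases i <;> fin_cases j <;>
      first
      | rfl
      | exact absurd h hxy
      | exact absurd h hyz
      | exact absurd h hxz
      | exact absurd h.symm hxy
      | exact absurd h.symm hyz
      | exact absurd h.symm hxz
  have hs : ∀ (a b : V) (h : a ≠ b), C.get a b h = C.get b a h.symm := fun a b h =>
    (C.get_comm a b _).symm
  refine ⟨⟨⟨![x, y, z], fun {i j} h => hinj.ne h⟩, hinj⟩, ?_⟩
  have key : ∀ (i j k l : Fin 3) (hij : i ≠ j) (hkl : k ≠ l),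
      C.get (![x, y, z] i) (![x, y, z] j) (hinj.ne hij) =
        C.get (![x, y, z] k) (![x, y, z] l) (hinj.ne hkl) → s(i, j) = s(k, l) := by
    have h4 := hs y x hxy.symm
    have h5 := hs z y hyz.symm
    have h6 := hs z x hxz.symm
    intro i j k l hij hkl h
    fin_cases i <;> fin_cases j <;> first | exact absurd rfl hij | skip
    all_goals fin_cases k <;> fin_cases l <;>
      first
      | exact absurd rfl hkl
      | rfl
      | exact Sym2.eq_swap
      | simp [h4, h5, h6, h1, h2, h3, h1.symm, h2.symm, h3.symm] at h
  rintro ⟨e, he⟩ ⟨e', he'⟩ h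
  induction e using Sym2.ind with
  | _ i j =>
    induction e' using Sym2.ind with
    | _ k l => exact Subtype.ext (key i j k l he he' h)

theorem HasRainbowCopy.exists_ne {V K : Type*} {C : SimpleGraph.TopEdgeLabeling V K}
    (h : HasRainbowCopy C (⊤ : SimpleGraph (Fin 3))) :
    ∃ (x y z : V) (hxy : x ≠ y) (hyz : y ≠ z) (hxz : x ≠ z),
      C.get x y hxy ≠ C.get y z hyz ∧ C.get y z hyz ≠ C.get x z hxz ∧
        C.get x y hxy ≠ C.get x z hxz := by
  obtain ⟨f, hf⟩ := h
  have hinj := f.injective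
  have h01 : (⊤ : SimpleGraph (Fin 3)).Adj 0 1 := by simp
  have h12 : (⊤ : SimpleGraph (Fin 3)).Adj 1 2 := by simp
  have h02 : (⊤ : SimpleGraph (Fin 3)).Adj 0 2 := by simp
  refine ⟨f 0, f 1, f 2, hinj.ne h01.ne, hinj.ne h12.ne, hinj.ne h02.ne, ?_, ?_, ?_⟩
  · exact hf.ne (a₁ := ⟨s(0, 1), h01⟩) (a₂ := ⟨s(1, 2), h12⟩) (by simp [Subtype.ext_iff])
  · exact hf.ne (a₁ := ⟨s(1, 2), h12⟩) (a₂ := ⟨s(0, 2), h02⟩) (by simp [Subtype.ext_iff])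
  · exact hf.ne (a₁ := ⟨s(0, 1), h01⟩) (a₂ := ⟨s(0, 2), h02⟩) (by simp [Subtype.ext_iff])

section

variable {V K : Type*} [DecidableEq V]

/-- The colour of an edge as a function of its two ends, with a default value on the diagonal. -/
def edgeColor [Inhabited K] (C : SimpleGraph.TopEdgeLabeling V K) (x y : V) : K :=
  if h : x ≠ y then C.get x y h else default

theorem edgeColor_of_ne [Inhabited K] (C : SimpleGraph.TopEdgeLabeling V K) {x y : V}
    (h : x ≠ y) : edgeColor C x y = C.get x y h :=
  dif_pos h

theorem edgeColor_comm [Inhabited K] (C : SimpleGraph.TopEdgeLabeling V K) (x y : V) :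
    edgeColor C x y = edgeColor C y x := by
  by_cases h : x = y
  · rw [h]
  · rw [edgeColor_of_ne C h, edgeColor_of_ne C (Ne.symm h)]
    exact (C.get_comm x y _).symm

theorem HasStar.hasMonochromaticCopy [Inhabited K] {C : SimpleGraph.TopEdgeLabeling V K} {t r : ℕ}
    (hrt : 2 * r + 1 ≤ t) (h : HasStar (edgeColor C) t r) :
    HasMonochromaticCopy C (starWithEdges t r) := by
  obtain ⟨i, v, N, hv, hvN, ht, hM⟩ := h
  have : Nonempty V := ⟨v⟩
  obtain ⟨e, heN, hinj, hce⟩ := hM.exists_injOn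
  have heinj : Set.InjOn e (Finset.range (2 * r)) := fun m hm n hn h =>
    hinj m (by simpa using hm) n (by simpa using hn) h
  obtain ⟨N', hN₁, hN₂, hcard⟩ := Finset.exists_subsuperset_card_eq (n := t - 1)
    (s := (Finset.range (2 * r)).image e) (t := N)
    (fun x hx => by
      obtain ⟨m, hm, rfl⟩ := Finset.mem_image.1 hx
      exact heN m (by simpa using hm))
    (by rw [Finset.card_image_of_injOn heinj, Finset.card_range]; omega) (by omega)
  -- The leaves are enumerated with the matched ones first; leaf `m + 1` of the star goes to `g m`,
  -- so the edge `{2 * j + 1, 2 * j + 2}` goes to the `j`-th matching edge.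
  obtain ⟨g, hg⟩ := Finset.exists_equiv_extend_of_card_eq (α := Fin (t - 1)) (t := N')
    (by simp [hcard]) (s := Finset.univ.filter (fun m => m.val < 2 * r)) (f := fun m => e m.val)
    (fun x hx => by
      obtain ⟨m, hm, rfl⟩ := Finset.mem_image.1 hx
      exact hN₁ (Finset.mem_image_of_mem e (by simpa using hm)))
    (fun m hm n hn h => Fin.ext (hinj m (by simpa using hm) n (by simpa using hn) h))
  let f : Fin t → V := fun a => if h : a.val = 0 then v else g ⟨a.val - 1, by omega⟩
  have hf0 : ∀ a : Fin t, a.val = 0 → f a = v := fun a h => dif_pos h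
  have hf1 : ∀ (a : Fin t) (m : ℕ) (hm : m < t - 1), a.val = m + 1 → f a = g ⟨m, hm⟩ := by
    intro a m hm ha
    have h0 : ¬ a.val = 0 := by omega
    have hm' : a.val - 1 = m := by omega
    simp only [f, h0, dif_neg, not_false_eq_true, hm']
  have hgN : ∀ m, (g m : V) ∈ N := fun m => hN₂ (g m).2
  have hfinj : Function.Injective f := by
    intro a b hab
    by_cases ha : a.val = 0 <;> by_cases hb : b.val = 0
    · exact Fin.ext (ha.trans hb.symm)
    · rw [hf0 a ha, hf1 b (b.val - 1) (by omega) (by omega)] at hab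
      exact absurd (hab ▸ hgN _) hv
    · rw [hf0 b hb, hf1 a (a.val - 1) (by omega) (by omega)] at hab
      exact absurd (hab ▸ hgN _) hv
    · rw [hf1 a (a.val - 1) (by omega) (by omega), hf1 b (b.val - 1) (by omega) (by omega)] at hab
      have := congrArg Fin.val (g.injective (Subtype.ext hab))
      simp only at this
      exact Fin.ext (by omega)
  have hadj : ∀ a b : Fin t, a ≠ b →
      (a.val = 0 ∨ ∃ j < r, a.val = 2 * j + 1 ∧ b.val = 2 * j + 2) →
      (C.labelGraph i).Adj (f a) (f b) := by
    intro a b hab h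
    rw [SimpleGraph.TopEdgeLabeling.labelGraph_adj]
    refine ⟨hfinj.ne hab, ?_⟩
    rw [← edgeColor_of_ne C (hfinj.ne hab)]
    rcases h with h | ⟨j, hj, ha, hb⟩
    · have hb : b.val ≠ 0 := fun hb => hab (Fin.ext (h.trans hb.symm))
      rw [hf0 a h, hf1 b (b.val - 1) (by omega) (by omega)]
      exact hvN _ (hgN _)
    · rw [hf1 a (2 * j) (by omega) ha, hf1 b (2 * j + 1) (by omega) hb,
        hg _ (by simp only [Finset.mem_filter, Finset.mem_univ, true_and]; omega),
        hg _ (by simp only [Finset.mem_filter, Finset.mem_univ, true_and]; omega)]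
      exact hce j hj
  refine ⟨i, ⟨⟨f, ?_⟩, hfinj⟩⟩
  intro a b hab
  rw [starWithEdges, SimpleGraph.fromRel_adj] at hab
  rcases hab with ⟨hne, h | h⟩
  · exact hadj a b hne h
  · exact (hadj b a hne.symm h).symm

end

theorem upperBound_mem_gallaiRamseySet {t s : ℕ} (ht : 2 * s + 3 ≤ t) (k : ℕ) :
    upperBound t s (k + 1) ∈ gallaiRamseySet (k + 1) (⊤ : SimpleGraph (Fin 3))
      (starWithEdges t (s + 1)) := by
  intro C
  by_contra! hcon
  have hr : RainbowTriangleFree (edgeColor C) := by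
    intro x y z hxy hyz hxz
    by_contra! h
    rw [edgeColor_of_ne C hxy, edgeColor_of_ne C hyz, edgeColor_of_ne C hxz] at h
    exact hcon.1 (hasRainbowCopy_of_ne hxy hyz hxz h.1 h.2.1 h.2.2)
  have h := card_lt_upperBound ht (fun h => hcon.2 (h.hasMonochromaticCopy (by omega)))
    (edgeColor_comm C) hr k Finset.univ (by simp) Finset.univ
    (fun _ _ _ _ _ => Finset.mem_univ _)
  simp at h

/-! ### The lower bound -/

/-- The colouring `c` has colours below `k`, no rainbow triangle, and no vertex of a monochromatic
triangle has `t - 1` neighbours in the colour of the triangle. -/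
structure IsStarFree {V : Type*} (c : V → V → ℕ) (k t : ℕ) : Prop where
  symm : ∀ x y, c x y = c y x
  lt : ∀ x y, c x y < k
  rainbowTriangleFree : RainbowTriangleFree c
  card_lt : ∀ (i : ℕ) (v x y : V) (N : Finset V), v ∉ N → (∀ z ∈ N, c v z = i) → x ∈ N → y ∈ N →
    x ≠ y → c x y = i → N.card + 1 < t

/-- Substituting the colouring `c` for each vertex of `Q`. -/
def blowUp {Q V : Type*} [DecidableEq Q] (d : Q → Q → ℕ) (c : V → V → ℕ) (x y : Q × V) : ℕ :=
  if x.1 = y.1 then c x.2 y.2 else d x.1 y.1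

theorem blowUp_of_eq {Q V : Type*} [DecidableEq Q] (d : Q → Q → ℕ) (c : V → V → ℕ)
    {x y : Q × V} (h : x.1 = y.1) : blowUp d c x y = c x.2 y.2 :=
  if_pos h

theorem blowUp_of_ne {Q V : Type*} [DecidableEq Q] (d : Q → Q → ℕ) (c : V → V → ℕ)
    {x y : Q × V} (h : x.1 ≠ y.1) : blowUp d c x y = d x.1 y.1 :=
  if_neg h

/-- A triangle meeting exactly two copies has two equal edges, so rainbow triangles could only come
from `c` or `d`. A colour below `k` lives inside single copies, where `c` controls it; a
monochromatic triangle in a new colour would project to one of `d`. -/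
theorem IsStarFree.blowUp {Q V : Type*} [DecidableEq Q] {d : Q → Q → ℕ} {c : V → V → ℕ}
    {k l t : ℕ} (hc : IsStarFree c k t) (hkl : k ≤ l) (hsymm : ∀ p q, d p q = d q p)
    (hd : ∀ p q, k ≤ d p q ∧ d p q < l) (hr : RainbowTriangleFree d)
    (htri : ∀ p q s, p ≠ q → q ≠ s → p ≠ s → d p q = d p s → d p q ≠ d q s) :
    IsStarFree (blowUp d c) l t where
  symm x y := by
    unfold GallaiRamsey.blowUp
    rw [hsymm, hc.symm]
    simp only [eq_comm]
  lt x y := by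
    unfold GallaiRamsey.blowUp
    split_ifs
    · exact (hc.lt _ _).trans_le hkl
    · exact (hd _ _).2
  rainbowTriangleFree := by
    rintro ⟨p, x⟩ ⟨q, y⟩ ⟨s, z⟩ hxy hyz hxz
    by_cases hpq : p = q
    · subst hpq
      by_cases hps : p = s
      · subst hps
        simp only [GallaiRamsey.blowUp, if_true]
        exact hc.rainbowTriangleFree x y z (by simpa using hxy) (by simpa using hyz)
          (by simpa using hxz)
      · simp [GallaiRamsey.blowUp, hps]
    · by_cases hqs : q = s
      · subst hqs
        simp [GallaiRamsey.blowUp, hpq]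
      · by_cases hps : p = s
        · subst hps
          simp [GallaiRamsey.blowUp, hpq, hqs, hsymm q p]
        · simp only [GallaiRamsey.blowUp, hpq, hqs, hps, if_false]
          exact hr p q s hpq hqs hps
  card_lt := by
    intro i v x y N hv hN hx hy hxy hi
    by_cases hik : i < k
    · have hfib : ∀ z w : Q × V, GallaiRamsey.blowUp d c z w = i → z.1 = w.1 := by
        intro z w h
        by_contra hzw
        rw [blowUp_of_ne d c hzw] at h
        have := (hd z.1 w.1).1
        omega
      have hNv : ∀ z ∈ N, v.1 = z.1 := fun z hz => hfib v z (hN z hz)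
      have hinj : Set.InjOn Prod.snd (N : Set (Q × V)) := fun z hz w hw h =>
        Prod.ext ((hNv z hz).symm.trans (hNv w hw)) h
      classical
      rw [← Finset.card_image_of_injOn hinj]
      have hxy1 := (hNv x hx).symm.trans (hNv y hy)
      refine hc.card_lt i v.2 x.2 y.2 _ ?_ ?_ (Finset.mem_image_of_mem _ hx)
        (Finset.mem_image_of_mem _ hy) (fun h => hxy (Prod.ext hxy1 h)) ?_
      · intro h
        obtain ⟨z, hz, hzv⟩ := Finset.mem_image.1 h
        exact hv (Prod.ext (hNv z hz).symm hzv ▸ hz)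
      · intro w hw
        obtain ⟨z, hz, rfl⟩ := Finset.mem_image.1 hw
        rw [← blowUp_of_eq d c (hNv z hz), hN z hz]
      · rw [← blowUp_of_eq d c hxy1, hi]
    · have hfib : ∀ z w : Q × V, GallaiRamsey.blowUp d c z w = i → z.1 ≠ w.1 := by
        intro z w h hzw
        rw [blowUp_of_eq d c hzw] at h
        have := hc.lt z.2 w.2
        omega
      have hvx := hN x hx
      have hvy := hN y hy
      have h1 := hfib _ _ hvx
      have h2 := hfib _ _ hvy
      have h3 := hfib _ _ hi
      rw [blowUp_of_ne d c h1] at hvx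
      rw [blowUp_of_ne d c h2] at hvy
      rw [blowUp_of_ne d c h3] at hi
      exact absurd (hvx.trans hi.symm) (htri _ _ _ h1 h3 h2 (hvx.trans hvy.symm))

/-- There is a star-free `k`-colouring of the complete graph on `n` vertices. -/
def ExistsStarFree (k t n : ℕ) : Prop :=
  ∃ (V : Type) (_ : Fintype V) (c : V → V → ℕ), Fintype.card V = n ∧ IsStarFree c k t

theorem existsStarFree_one {t : ℕ} (ht : 1 ≤ t) : ExistsStarFree 1 t (t - 1) := by
  refine ⟨Fin (t - 1), inferInstance, fun _ _ => 0, by simp, fun _ _ => rfl, fun _ _ => by simp,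
    fun _ _ _ _ _ _ => Or.inl rfl, ?_⟩
  intro i v x y N hv _ _ _ _ _
  have := Finset.card_lt_univ_of_notMem hv
  rw [Fintype.card_fin] at this
  omega

theorem ExistsStarFree.two_mul {k t n : ℕ} (h : ExistsStarFree k t n) :
    ExistsStarFree (k + 1) t (2 * n) := by
  obtain ⟨V, _, c, hV, hc⟩ := h
  refine ⟨Bool × V, inferInstance, GallaiRamsey.blowUp (fun _ _ => k) c, by simp [hV],
    hc.blowUp (by omega) (fun _ _ => rfl) (fun _ _ => by omega) (fun _ _ _ _ _ _ => Or.inl rfl) ?_⟩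
  have hB : ∀ p q s : Bool, p ≠ q → q ≠ s → ¬ p ≠ s := by decide
  exact fun p q s hpq hqs hps => absurd hps (hB p q s hpq hqs)

theorem ExistsStarFree.five_mul {k t n : ℕ} (h : ExistsStarFree k t n) :
    ExistsStarFree (k + 2) t (5 * n) := by
  obtain ⟨V, _, c, hV, hc⟩ := h
  -- The pentagon and its complement, again a pentagon, are triangle-free.
  let b : Fin 5 → Fin 5 → Bool := fun p q => p - q = 1 ∨ q - p = 1
  let d : Fin 5 → Fin 5 → ℕ := fun p q => if b p q then k else k + 1
  have hinj : ∀ p q p' q', d p q = d p' q' ↔ b p q = b p' q' := by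
    intro p q p' q'
    simp only [d]
    cases b p q <;> cases b p' q' <;> simp
  refine ⟨Fin 5 × V, inferInstance, GallaiRamsey.blowUp d c, by simp [hV],
    hc.blowUp (by omega) ?_ ?_ ?_ ?_⟩
  · simp only [hinj, b]
    decide
  · intro p q
    simp only [d]
    split_ifs <;> omega
  · simp only [RainbowTriangleFree, hinj, b]
    decide
  · simp only [ne_eq, hinj, b]
    decide

/-- The colouring is restricted along an embedding. As `r ≥ 1`, a copy of the star has a triangle at
its centre, which has `t - 1` neighbours in that colour. -/
theorem ExistsStarFree.notMem_gallaiRamseySet {k t r n m : ℕ} (h : ExistsStarFree k t n)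
    (hr : 1 ≤ r) (hrt : 2 * r + 1 ≤ t) (hm : m ≤ n) :
    m ∉ gallaiRamseySet k (⊤ : SimpleGraph (Fin 3)) (starWithEdges t r) := by
  classical
  obtain ⟨V, _, c, hV, hc⟩ := h
  obtain ⟨e⟩ : Nonempty (Fin m ↪ V) :=
    Function.Embedding.nonempty_of_card_le (by simpa [hV] using hm)
  intro hmem
  rcases hmem (SimpleGraph.EdgeLabeling.mk (fun x y _ => ⟨c (e x) (e y), hc.lt _ _⟩)
    (fun x y _ => Fin.ext (hc.symm _ _))) with h | ⟨i, ⟨f⟩⟩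
  · obtain ⟨x, y, z, hxy, hyz, hxz, h⟩ := h.exists_ne
    simp only [SimpleGraph.EdgeLabeling.get_mk, ne_eq, Fin.mk.injEq] at h
    have := hc.rainbowTriangleFree _ _ _ (e.injective.ne hxy) (e.injective.ne hyz)
      (e.injective.ne hxz)
    tauto
  · have hadj : ∀ a b : Fin t, (starWithEdges t r).Adj a b → c (e (f a)) (e (f b)) = i := by
      intro a b hab
      obtain ⟨_, h⟩ := (SimpleGraph.TopEdgeLabeling.labelGraph_adj _ _).1 (f.toHom.map_adj hab)
      exact congrArg Fin.val h
    have hinj : Function.Injective fun a => e (f a) := e.injective.comp f.injective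
    let o : Fin t := ⟨0, by omega⟩
    have h0 : ∀ a : Fin t, a ≠ o → (starWithEdges t r).Adj o a := by
      intro a ha
      rw [starWithEdges, SimpleGraph.fromRel_adj]
      exact ⟨ha.symm, Or.inl (Or.inl rfl)⟩
    have h12 : (starWithEdges t r).Adj ⟨1, by omega⟩ ⟨2, by omega⟩ := by
      rw [starWithEdges, SimpleGraph.fromRel_adj]
      exact ⟨by simp, Or.inl (Or.inr ⟨0, by omega, rfl, rfl⟩)⟩
    have h := hc.card_lt i (e (f o)) (e (f ⟨1, by omega⟩)) (e (f ⟨2, by omega⟩))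
      ((Finset.univ.erase o).image fun a => e (f a))
      (by
        intro h
        obtain ⟨a, ha, hao⟩ := Finset.mem_image.1 h
        exact Finset.ne_of_mem_erase ha (hinj hao))
      (by
        intro w hw
        obtain ⟨a, ha, rfl⟩ := Finset.mem_image.1 hw
        exact hadj _ _ (h0 a (Finset.ne_of_mem_erase ha)))
      (Finset.mem_image_of_mem _ (by simp [o])) (Finset.mem_image_of_mem _ (by simp [o]))
      (hinj.ne (by simp)) (hadj _ _ h12)
    rw [Finset.card_image_of_injective _ hinj, Finset.card_erase_of_mem (Finset.mem_univ _)] at h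
    simp only [Finset.card_univ, Fintype.card_fin] at h
    omega

theorem ExistsStarFree.lt_gallaiRamseyNumber {k t r n : ℕ} (h : ExistsStarFree k t n)
    (hr : 1 ≤ r) (hrt : 2 * r + 1 ≤ t)
    (hne : (gallaiRamseySet k (⊤ : SimpleGraph (Fin 3)) (starWithEdges t r)).Nonempty) :
    n < gallaiRamseyNumber k (⊤ : SimpleGraph (Fin 3)) (starWithEdges t r) := by
  by_contra! hle
  exact h.notMem_gallaiRamseySet hr hrt hle (Nat.sInf_mem hne)

theorem existsStarFree_odd {t : ℕ} (ht : 1 ≤ t) (j : ℕ) :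
    ExistsStarFree (2 * j + 1) t ((t - 1) * 5 ^ j) := by
  induction j with
  | zero => simpa using existsStarFree_one ht
  | succ j ih =>
    have h := ih.five_mul
    rwa [show 5 * ((t - 1) * 5 ^ j) = (t - 1) * 5 ^ (j + 1) by ring] at h

theorem existsStarFree_even {t : ℕ} (ht : 1 ≤ t) (j : ℕ) :
    ExistsStarFree (2 * j + 2) t (2 * (t - 1) * 5 ^ j) := by
  have h := (existsStarFree_odd ht j).two_mul
  rwa [← mul_assoc] at h

/-- Adding `4 * s` turns the recursion into multiplication by `5`. -/
theorem upperBound_odd (t s j : ℕ) :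
    upperBound t s (2 * j + 1) + 4 * s = (t + 4 * s) * 5 ^ j := by
  induction j with
  | zero => simp [upperBound]
  | succ j ih =>
    change 5 * upperBound t s (2 * j + 1) + 16 * s + 4 * s = _
    rw [pow_succ, ← mul_assoc, ← ih]
    ring

theorem upperBound_even (t s j : ℕ) :
    upperBound t s (2 * j + 2) + 4 * s = (2 * t + 8 * s) * 5 ^ j := by
  induction j with
  | zero => simp only [upperBound, pow_zero]; ring
  | succ j ih =>
    change 5 * upperBound t s (2 * j + 2) + 16 * s + 4 * s = _
    rw [pow_succ, ← mul_assoc, ← ih]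
    ring

end GallaiRamsey

theorem theorem1p4 (k t r : ℕ) (hk : 1 ≤ k) (hr : 1 ≤ r) (hrt : 2 * r + 1 ≤ t)
    (ht : 6 * (r : ℤ) - 5 ≤ (t : ℤ)) :
    (GallaiRamsey.gallaiRamseySet k (⊤ : SimpleGraph (Fin 3))
      (GallaiRamsey.starWithEdges t r)).Nonempty ∧
    (Even k →
      2 * ((t : ℤ) - 1) * 5 ^ ((k - 2) / 2) + 1 ≤
        (GallaiRamsey.gallaiRamseyNumber k (⊤ : SimpleGraph (Fin 3))
          (GallaiRamsey.starWithEdges t r) : ℤ) ∧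
      (GallaiRamsey.gallaiRamseyNumber k (⊤ : SimpleGraph (Fin 3))
          (GallaiRamsey.starWithEdges t r) : ℤ) ≤
        (2 * (t : ℤ) + 8 * ((r : ℤ) - 1)) * 5 ^ ((k - 2) / 2) - 4 * ((r : ℤ) - 1)) ∧
    (Odd k →
      ((t : ℤ) - 1) * 5 ^ ((k - 1) / 2) + 1 ≤
        (GallaiRamsey.gallaiRamseyNumber k (⊤ : SimpleGraph (Fin 3))
          (GallaiRamsey.starWithEdges t r) : ℤ) ∧
      (GallaiRamsey.gallaiRamseyNumber k (⊤ : SimpleGraph (Fin 3))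
          (GallaiRamsey.starWithEdges t r) : ℤ) ≤
        ((t : ℤ) + 4 * ((r : ℤ) - 1)) * 5 ^ ((k - 1) / 2) - 4 * ((r : ℤ) - 1)) := by
  obtain ⟨s, rfl⟩ : ∃ s, r = s + 1 := ⟨r - 1, by omega⟩
  have hmem : GallaiRamsey.upperBound t s k ∈ GallaiRamsey.gallaiRamseySet k
      (⊤ : SimpleGraph (Fin 3)) (GallaiRamsey.starWithEdges t (s + 1)) := by
    obtain ⟨k, rfl⟩ : ∃ l, k = l + 1 := ⟨k - 1, by omega⟩
    exact GallaiRamsey.upperBound_mem_gallaiRamseySet (by omega) k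
  have hle : GallaiRamsey.gallaiRamseyNumber k (⊤ : SimpleGraph (Fin 3))
      (GallaiRamsey.starWithEdges t (s + 1)) ≤ GallaiRamsey.upperBound t s k := Nat.sInf_le hmem
  refine ⟨⟨_, hmem⟩, fun hev => ?_, fun hodd => ?_⟩
  · obtain ⟨j, rfl⟩ : ∃ j, k = 2 * j + 2 := by
      obtain ⟨j, rfl⟩ := hev
      exact ⟨j - 1, by omega⟩
    have hlt := (GallaiRamsey.existsStarFree_even (t := t) (by omega) j).lt_gallaiRamseyNumber
      hr hrt ⟨_, hmem⟩
    have hub := GallaiRamsey.upperBound_even t s j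
    rw [show (2 * j + 2 - 2) / 2 = j by omega]
    zify [show 1 ≤ t by omega] at hlt hle hub
    push_cast
    constructor <;> linarith
  · obtain ⟨j, rfl⟩ := hodd
    have hlt := (GallaiRamsey.existsStarFree_odd (t := t) (by omega) j).lt_gallaiRamseyNumber
      hr hrt ⟨_, hmem⟩
    have hub := GallaiRamsey.upperBound_odd t s j
    rw [show (2 * j + 1 - 1) / 2 = j by omega]
    zify [show 1 ≤ t by omega] at hlt hle hub
    push_cast
    constructor <;> linarith
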